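/- Let $d\ge 1$ and let $\mathcal P_d$ be the set of $d\times d$ stochastic matrices (non-negative entries, all row sums equal to $1$). For a positive vector $a=(a_1,\dots,a_d)$ let $G_a$ be the law of a vector of $d$ independent gamma random variables with scale parameter $1$ and shape parameters $a_1,\dots,a_d$, and let $D_a$ be the Dirichlet distribution on the standard simplex $\{x\in[0,1]^d: x_1+\dots+x_d=1\}$, with density $\Gamma(a_1+\dots+a_d)\prod_{i=1}^d x_i^{a_i-1}/\Gamma(a_i)$ with respect to the $(d-1)$-dimensional volume measure $dx_1\cdots dx_{d-1}$ (for $d=1$, the unit mass at the point $1$). Let $X(1),X(2),\dots$ be i.i.d. random elements of $\mathcal P_d$, and suppose that the following two conditions hold. [C1] There is a vector $t=(t_1,\dots,t_d)$ with positive components such that, if the random row vector $V\sim G_t$ is independent of $X(1)$, then $VX(1)$ has the same distribution as $V$. [C2] There is a positive integer $m$ such that, with positive probability, all entries of the product $X(m)X(m-1)\cdots X(1)$ are positive. Let $E$ be a real affine space of dimension $d-1$ and let $p_1,\dots,p_d\in E$ be the vertices of a (non-degenerate) simplex. Put $p_k(0)=p_k$ and, for $n\ge 1$ and $k=1,\dots,d$,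 let $p_k(n)$ be the point whose barycentric coordinates with respect to $(p_1(n-1),\dots,p_d(n-1))$ are given by the $k$-th row of $X(n)$, that is, $p_k(n)=\sum_{j=1}^d X(n)_{k,j}\,p_j(n-1)$. Then there is a random point $Y$ of $E$ such that, almost surely, $p_k(n)\to Y$ as $n\to\infty$ for every $k=1,\dots,d$. Furthermore, the vector of barycentric coordinates of $Y$ with respect to $(p_1,\dots,p_d)$ has the distribution $D_t$, where $t$ is the vector from [C1]. -/

import Mathlib

open MeasureTheory ProbabilityTheory Filter Topology

noncomputable section

namespace NestedSimplices

/-! Throughout, `d = r + 1` is a positive integer and `Fin (r + 1)` is the index set `{1, …, d}`. -/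

/-- Matrices carry the product σ-algebra of their entries (the Borel σ-algebra of `ℝ^(m × n)`). -/
instance instMeasurableSpaceMatrix {m n : Type*} : MeasurableSpace (Matrix m n ℝ) :=
  inferInstanceAs (MeasurableSpace (m → n → ℝ))

/-- The parametrization of the hyperplane `x₁ + ⋯ + x_d = 1` in `ℝ^d` by the first `d - 1`
coordinates. -/
def hyperplaneChart (r : ℕ) (x : Fin r → ℝ) : Fin (r + 1) → ℝ :=
  Fin.snoc (α := fun _ => ℝ) x (1 - ∑ i, x i)

/-- The `(d - 1)`-dimensional volume measure on the standard simplex of `ℝ^d`, in the normalization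
`dx₁ ⋯ dx_{d-1}` for which the Dirichlet density has total mass one (for `d = 1` it is the unit mass
at the only point of the simplex). -/
def simplexVolume (r : ℕ) : Measure (Fin (r + 1) → ℝ) :=
  ((volume : Measure (Fin r → ℝ)).map (hyperplaneChart r)).restrict (stdSimplex ℝ (Fin (r + 1)))

/-- The Dirichlet density `Γ(a₁ + ⋯ + a_d) ∏ᵢ xᵢ ^ (aᵢ - 1) / Γ(aᵢ)`. -/
def dirichletPDFReal {r : ℕ} (a : Fin (r + 1) → ℝ) (x : Fin (r + 1) → ℝ) : ℝ :=
  Real.Gamma (∑ i, a i) * ∏ i, (x i ^ (a i - 1) / Real.Gamma (a i))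

/-- The Dirichlet distribution `D_a` (meaningful for positive vectors `a`). -/
def dirichletMeasure {r : ℕ} (a : Fin (r + 1) → ℝ) : Measure (Fin (r + 1) → ℝ) :=
  (simplexVolume r).withDensity fun x => ENNReal.ofReal (dirichletPDFReal a x)

/-- The law `G_a` of a vector of independent gamma variables with shapes `a₁, …, a_d` and
scale `1`. -/
def gammaVectorMeasure {r : ℕ} (a : Fin (r + 1) → ℝ) : Measure (Fin (r + 1) → ℝ) :=
  Measure.pi fun i => gammaMeasure (a i) 1

/-- Condition **C1** for the random matrix `X`, with the parameter vector `t`: `t` is positive and,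
if `V ∼ G_t` is independent of `X`, then the row vector `V X` has the law `G_t` again. The joint law
of such a pair `(V, X)` is the product of `G_t` and the law of `X`. -/
def CondC1 {r : ℕ} {Ω : Type*} [MeasurableSpace Ω] (μ : Measure Ω)
    (X : Ω → Matrix (Fin (r + 1)) (Fin (r + 1)) ℝ) (t : Fin (r + 1) → ℝ) : Prop :=
  (∀ i, 0 < t i) ∧
    ((gammaVectorMeasure t).prod (μ.map X)).map (fun q => Matrix.vecMul q.1 q.2) =
      gammaVectorMeasure t

/-- The left products `X(n, 1) = X(n) X(n-1) ⋯ X(1)` of a sequence of matrices. The sequence is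
indexed from `0`: the term `X n` stands for `X(n+1)`. -/
def leftProd {r : ℕ} (X : ℕ → Matrix (Fin (r + 1)) (Fin (r + 1)) ℝ) :
    ℕ → Matrix (Fin (r + 1)) (Fin (r + 1)) ℝ
  | 0 => 1
  | n + 1 => X n * leftProd X n

/-- Condition **C2**, for an i.i.d. sequence `X` of random stochastic matrices: some left product
`X(m, 1)`, `m ≥ 1`, has all its entries positive with positive probability. -/
def CondC2 {r : ℕ} {Ω : Type*} [MeasurableSpace Ω] (μ : Measure Ω)
    (X : ℕ → Ω → Matrix (Fin (r + 1)) (Fin (r + 1)) ℝ) : Prop :=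
  ∃ m : ℕ, 1 ≤ m ∧ 0 < μ {ω | ∀ i j, 0 < leftProd (fun n => X n ω) m i j}

/-- The vertices of the nested simplices: `p_k(0) = p_k`, and `p_k(n+1)` is the point whose
barycentric coordinates with respect to `(p_1(n), …, p_d(n))` form the `k`-th row of `X(n+1)`
(which is the term `X n` of the sequence). -/
def nestedVertices {r : ℕ} {V P : Type*} [AddCommGroup V] [Module ℝ V] [AddTorsor V P]
    (p : Fin (r + 1) → P) (X : ℕ → Matrix (Fin (r + 1)) (Fin (r + 1)) ℝ) :
    ℕ → Fin (r + 1) → P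
  | 0 => p
  | n + 1 => fun k => Finset.univ.affineCombination ℝ (nestedVertices p X n) (X n k)

end NestedSimplices

end

noncomputable section

namespace NestedSimplices

/-! ### Stochastic matrices, oscillation and barycentric coordinates -/

section Deterministic

variable {r : ℕ}

/-! Barycentric coordinates compose by matrix multiplication: the `k`-th vertex at time `n` has as
coordinates the `k`-th row of the left product (`nestedVertices_eq_affineCombination`). Both claims
thus concern these products.

Convergence: a stochastic left factor replaces rows by convex averages of rows, so the spread of
each column never grows, and it shrinks by `1 - δ` if all entries of the factor are at least `δ`. By
C2, for some `δ > 0`, each of the i.i.d. blocks of length `m` does this with the same positive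
probability. The expected bound on the spread decays geometrically, so the bounds are almost surely
summable and tend to zero: all rows merge into one random row `y` (`ae_exists_tendsto_leftProd`).

Law: by C1 and independence, `V ∼ G_t` times any left product is again `G_t`
(`map_vecMul_leftProd`). In the limit `(∑ Vᵢ) y ∼ G_t` (`map_sum_smul_eq_of_tendsto`). Dividing by
the coordinate sum turns the left side into `y`, and the right side into `D_t` by the classical
gamma–Dirichlet relation (`map_normalize_gammaVectorMeasure`). -/

theorem leftProd_mem_rowStochastic {x : ℕ → Matrix (Fin (r + 1)) (Fin (r + 1)) ℝ}
    (hx : ∀ n, x n ∈ Matrix.rowStochastic ℝ (Fin (r + 1))) (n : ℕ) :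
    leftProd x n ∈ Matrix.rowStochastic ℝ (Fin (r + 1)) := by
  induction n with
  | zero => exact one_mem _
  | succ n ih => exact mul_mem (hx n) ih

theorem leftProd_add (x : ℕ → Matrix (Fin (r + 1)) (Fin (r + 1)) ℝ) (m n : ℕ) :
    leftProd x (m + n) = leftProd (fun i => x (m + i)) n * leftProd x m := by
  induction n with
  | zero => simp [leftProd]
  | succ n ih =>
    change x (m + n) * leftProd x (m + n) = (x (m + n) * leftProd (fun i => x (m + i)) n) * _
    rw [ih, Matrix.mul_assoc]

theorem leftProd_congr {x y : ℕ → Matrix (Fin (r + 1)) (Fin (r + 1)) ℝ} {n : ℕ}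
    (h : ∀ i < n, x i = y i) : leftProd x n = leftProd y n := by
  induction n with
  | zero => rfl
  | succ n ih =>
    simp only [leftProd]
    rw [h n n.lt_succ_self, ih fun i hi => h i (hi.trans n.lt_succ_self)]

/-- A stochastic matrix with entries at least `δ` contracts oscillations by the factor `1 - δ`. -/
theorem abs_mulVec_sub_mulVec_le {A : Matrix (Fin (r + 1)) (Fin (r + 1)) ℝ}
    (hA : A ∈ Matrix.rowStochastic ℝ (Fin (r + 1))) {δ : ℝ} (hδ : ∀ i j, δ ≤ A i j)
    {v : Fin (r + 1) → ℝ} {c : ℝ} (hc : ∀ k l, |v k - v l| ≤ c) (k l : Fin (r + 1)) :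
    |A.mulVec v k - A.mulVec v l| ≤ (1 - δ) * c := by
  obtain ⟨q, hq⟩ := Finite.exists_min v
  have hc0 : 0 ≤ c := (abs_nonneg _).trans (hc q q)
  have hrow (i) : A.mulVec v i = v q + ∑ j, A i j * (v j - v q) := by
    simp only [mul_sub, Finset.sum_sub_distrib, ← Finset.sum_mul,
      Matrix.sum_row_of_mem_rowStochastic hA i, Matrix.mulVec, dotProduct]
    ring
  have hlow (i) : v q ≤ A.mulVec v i := by
    rw [hrow]
    have : 0 ≤ ∑ j, A i j * (v j - v q) := Finset.sum_nonneg fun j _ =>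
      mul_nonneg (Matrix.nonneg_of_mem_rowStochastic hA) (sub_nonneg.2 (hq j))
    linarith
  have hupp (i) : A.mulVec v i ≤ v q + (1 - δ) * c := by
    rw [hrow]
    -- The minimizer `q` contributes zero instead of up to `A i q * c ≥ δ * c`; this saving is the
    -- contraction.
    have h1 : ∑ j, A i j * (v j - v q) ≤ ∑ j, (A i j * c - if j = q then A i q * c else 0) := by
      refine Finset.sum_le_sum fun j _ => ?_
      split_ifs with h
      · simp [h]
      · rw [sub_zero]
        exact mul_le_mul_of_nonneg_left ((le_abs_self _).trans (hc j q))
          (Matrix.nonneg_of_mem_rowStochastic hA)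
    rw [Finset.sum_sub_distrib, ← Finset.sum_mul, Matrix.sum_row_of_mem_rowStochastic hA i,
      Finset.sum_ite_eq' Finset.univ q] at h1
    simp only [Finset.mem_univ, if_true] at h1
    nlinarith [hδ i q]
  rw [abs_le]
  constructor <;> linarith [hlow k, hlow l, hupp k, hupp l]

/-- Entries of `A v` are convex averages of entries of `v`. Applied to the columns of a left product
at time `N`, this controls all later rows at once and gives the Cauchy property. -/
theorem abs_mulVec_sub_le {A : Matrix (Fin (r + 1)) (Fin (r + 1)) ℝ}
    (hA : A ∈ Matrix.rowStochastic ℝ (Fin (r + 1)))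
    {v : Fin (r + 1) → ℝ} {c : ℝ} (hc : ∀ k l, |v k - v l| ≤ c) (k l : Fin (r + 1)) :
    |A.mulVec v k - v l| ≤ c := by
  have h : A.mulVec v k - v l = ∑ j, A k j * (v j - v l) := by
    simp only [mul_sub, Finset.sum_sub_distrib, ← Finset.sum_mul,
      Matrix.sum_row_of_mem_rowStochastic hA k, Matrix.mulVec, dotProduct, one_mul]
  rw [h]
  calc |∑ j, A k j * (v j - v l)| ≤ ∑ j, |A k j * (v j - v l)| := Finset.abs_sum_le_sum_abs _ _
    _ ≤ ∑ j, A k j * c := Finset.sum_le_sum fun j _ => by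
        rw [abs_mul, abs_of_nonneg (Matrix.nonneg_of_mem_rowStochastic hA)]
        exact mul_le_mul_of_nonneg_left (hc j l) (Matrix.nonneg_of_mem_rowStochastic hA)
    _ = c := by rw [← Finset.sum_mul, Matrix.sum_row_of_mem_rowStochastic hA k, one_mul]

/-- If the oscillations of the columns of the left products become arbitrarily small, then the
left products converge to a matrix with equal rows. -/
theorem exists_tendsto_leftProd {x : ℕ → Matrix (Fin (r + 1)) (Fin (r + 1)) ℝ}
    (hx : ∀ n, x n ∈ Matrix.rowStochastic ℝ (Fin (r + 1)))
    (h : ∀ ε > 0, ∃ n, ∀ k l j, |leftProd x n k j - leftProd x n l j| ≤ ε) :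
    ∃ y : Fin (r + 1) → ℝ, ∀ k, Tendsto (fun n => leftProd x n k) atTop (𝓝 y) := by
  have key : ∀ ε > 0, ∃ N, ∀ n ≥ N, ∀ k l j, |leftProd x n k j - leftProd x N l j| ≤ ε := by
    intro ε hε
    obtain ⟨N, hN⟩ := h ε hε
    refine ⟨N, fun n hn k l j => ?_⟩
    obtain ⟨q, rfl⟩ := Nat.exists_eq_add_of_le hn
    rw [leftProd_add]
    exact abs_mulVec_sub_le (leftProd_mem_rowStochastic (fun i => hx (N + i)) q)
      (v := fun i => leftProd x N i j) (fun k l => hN k l j) k l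
  have hcau (j) : CauchySeq fun n => leftProd x n 0 j := by
    rw [Metric.cauchySeq_iff']
    intro ε hε
    obtain ⟨N, hN⟩ := key (ε / 2) (half_pos hε)
    exact ⟨N, fun n hn => (hN n hn 0 0 j).trans_lt (half_lt_self hε)⟩
  choose y hy using fun j => cauchySeq_tendsto_of_complete (hcau j)
  refine ⟨y, fun k => tendsto_pi_nhds.2 fun j => ?_⟩
  have hdiff : Tendsto (fun n => leftProd x n k j - leftProd x n 0 j) atTop (𝓝 0) := by
    rw [Metric.tendsto_atTop]
    intro ε hε
    obtain ⟨N, hN⟩ := key (ε / 3) (by positivity)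
    refine ⟨N, fun n hn => ?_⟩
    rw [Real.dist_eq, sub_zero]
    have h1 := abs_le.1 (hN n hn k 0 j)
    have h2 := abs_le.1 (hN n hn 0 0 j)
    rw [abs_lt]
    constructor <;> linarith
  simpa using hdiff.add (hy j)

theorem nestedVertices_eq_affineCombination {V P : Type*} [AddCommGroup V] [Module ℝ V]
    [AddTorsor V P] (p : Fin (r + 1) → P) {x : ℕ → Matrix (Fin (r + 1)) (Fin (r + 1)) ℝ}
    (hx : ∀ n, x n ∈ Matrix.rowStochastic ℝ (Fin (r + 1))) (n : ℕ) (k : Fin (r + 1)) :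
    nestedVertices p x n k = Finset.univ.affineCombination ℝ p (leftProd x n k) := by
  induction n generalizing k with
  | zero =>
    have h := Finset.univ.affineCombination_of_eq_one_of_eq_zero (k := ℝ) (leftProd x 0 k) p
      (Finset.mem_univ k) (by simp [leftProd])
      (fun j _ hj => by simp [leftProd, Matrix.one_apply_ne' hj])
    exact h.symm
  | succ n ih =>
    have hs (i) : ∑ j, leftProd x n i j = 1 :=
      Matrix.sum_row_of_mem_rowStochastic (leftProd_mem_rowStochastic hx n) i
    simp only [nestedVertices]
    rw [Finset.affineCombination_eq_weightedVSubOfPoint_vadd_of_sum_eq_one _ _ _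
        (Matrix.sum_row_of_mem_rowStochastic (hx n) k) (p 0),
      Finset.affineCombination_eq_weightedVSubOfPoint_vadd_of_sum_eq_one _ _ _
        (Matrix.sum_row_of_mem_rowStochastic (leftProd_mem_rowStochastic hx (n + 1)) k) (p 0)]
    congr 1
    simp only [Finset.weightedVSubOfPoint_apply]
    -- With `p 0` as origin, affine combinations become linear ones and the claim is associativity
    -- of double sums.
    have h1 (i) : nestedVertices p x n i -ᵥ p 0 = ∑ j, leftProd x n i j • (p j -ᵥ p 0) := by
      rw [ih, Finset.affineCombination_eq_weightedVSubOfPoint_vadd_of_sum_eq_one _ _ _ (hs i) (p 0),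
        vadd_vsub, Finset.weightedVSubOfPoint_apply]
    simp only [h1, Finset.smul_sum, leftProd, Matrix.mul_apply, Finset.sum_smul, smul_smul]
    rw [Finset.sum_comm]

theorem continuous_affineCombination {ι V P : Type*} [Fintype ι] [Nonempty ι]
    [NormedAddCommGroup V] [NormedSpace ℝ V] [MetricSpace P] [NormedAddTorsor V P] (p : ι → P) :
    Continuous fun w : ι → ℝ => Finset.univ.affineCombination ℝ p w := by
  simp only [Finset.affineCombination_apply, Finset.weightedVSubOfPoint_apply]
  fun_prop

end Deterministic

/-! ### Almost sure merging of the rows -/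

section Convergence

/-- Each function factors through the restriction to its finite index set: extending by an arbitrary
constant outside the set does not change its value. Blocks can thus stay functions of the whole
sequence. -/
theorem _root_.ProbabilityTheory.iIndepFun.indepFun_of_dependsOn {ι Ω α β γ : Type*}
    [MeasurableSpace Ω] [MeasurableSpace α] [Nonempty α] [MeasurableSpace β] [MeasurableSpace γ]
    {μ : Measure Ω} {X : ι → Ω → α} (hX : iIndepFun X μ) (hm : ∀ i, Measurable (X i))
    {S T : Finset ι} (hST : Disjoint S T) {F : (ι → α) → β} {G : (ι → α) → γ}
    (hF : Measurable F) (hG : Measurable G) (hFS : DependsOn F S) (hGT : DependsOn G T) :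
    IndepFun (fun ω => F fun i => X i ω) (fun ω => G fun i => X i ω) μ := by
  classical
  let a : α := Classical.arbitrary α
  let ext (U : Finset ι) (z : U → α) (i : ι) : α := if h : i ∈ U then z ⟨i, h⟩ else a
  have hext (U : Finset ι) : Measurable (ext U) := by
    refine measurable_pi_lambda _ fun i => ?_
    by_cases h : i ∈ U
    · simpa [ext, h] using measurable_pi_apply _
    · simp [ext, h]
  have h := (hX.indepFun_finset S T hST hm).comp (hF.comp (hext S)) (hG.comp (hext T))
  convert h using 1
  · funext ω
    exact hFS fun i hi => by simp [ext, Finset.mem_coe.1 hi]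
  · funext ω
    exact hGT fun i hi => by simp [ext, Finset.mem_coe.1 hi]

variable {r : ℕ}

theorem measurable_entry {m n : Type*} (i : m) (j : n) :
    Measurable fun A : Matrix m n ℝ => A i j :=
  (measurable_pi_apply j).comp (measurable_pi_apply (X := fun _ : m => n → ℝ) i)

theorem measurable_matrix_of_entries {α m n : Type*} [MeasurableSpace α] {f : α → Matrix m n ℝ}
    (hf : ∀ i j, Measurable fun a => f a i j) : Measurable f :=
  measurable_pi_lambda (X := fun _ : m => n → ℝ) f fun i => measurable_pi_lambda _ fun j => hf i j

theorem measurable_matrix_mul :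
    Measurable fun q : Matrix (Fin (r + 1)) (Fin (r + 1)) ℝ × Matrix (Fin (r + 1)) (Fin (r + 1)) ℝ =>
      q.1 * q.2 := by
  refine measurable_matrix_of_entries fun i j => ?_
  simp only [Matrix.mul_apply]
  exact Finset.measurable_sum _ fun k _ => ((measurable_entry i k).comp measurable_fst).mul
    ((measurable_entry k j).comp measurable_snd)

theorem measurable_vecMul :
    Measurable fun q : (Fin (r + 1) → ℝ) × Matrix (Fin (r + 1)) (Fin (r + 1)) ℝ =>
      Matrix.vecMul q.1 q.2 := by
  refine measurable_pi_lambda _ fun j => ?_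
  simp only [Matrix.vecMul, dotProduct]
  exact Finset.measurable_sum _ fun k _ => ((measurable_pi_apply k).comp measurable_fst).mul
    ((measurable_entry k j).comp measurable_snd)

theorem measurable_leftProd (n : ℕ) :
    Measurable fun x : ℕ → Matrix (Fin (r + 1)) (Fin (r + 1)) ℝ => leftProd x n := by
  induction n with
  | zero => exact measurable_const
  | succ n ih => exact measurable_matrix_mul.comp ((measurable_pi_apply n).prodMk ih)

/-- The `i`-th of the consecutive blocks of length `m` of a left product. -/
def blockProd (m i : ℕ) (x : ℕ → Matrix (Fin (r + 1)) (Fin (r + 1)) ℝ) :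
    Matrix (Fin (r + 1)) (Fin (r + 1)) ℝ :=
  leftProd (fun k => x (m * i + k)) m

theorem measurable_blockProd (m i : ℕ) : Measurable (blockProd (r := r) m i) :=
  (measurable_leftProd m).comp (measurable_pi_lambda _ fun _ => measurable_pi_apply _)

open Classical in
/-- The contraction factor `1 - δ` of a matrix whose entries are at least `δ`, and `1` for the
other matrices. -/
def contraction (δ : ℝ) (A : Matrix (Fin (r + 1)) (Fin (r + 1)) ℝ) : ℝ :=
  if ∀ i j, δ ≤ A i j then 1 - δ else 1

theorem measurableSet_forall_le_entry (δ : ℝ) :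
    MeasurableSet {A : Matrix (Fin (r + 1)) (Fin (r + 1)) ℝ | ∀ i j, δ ≤ A i j} := by
  simp only [Set.ofPred_forall]
  exact MeasurableSet.iInter fun i => MeasurableSet.iInter fun j =>
    measurableSet_le measurable_const (measurable_entry i j)

theorem measurable_contraction (δ : ℝ) : Measurable (contraction (r := r) δ) :=
  Measurable.ite (measurableSet_forall_le_entry δ) measurable_const measurable_const

theorem contraction_nonneg {δ : ℝ} (h1 : δ ≤ 1)
    (A : Matrix (Fin (r + 1)) (Fin (r + 1)) ℝ) : 0 ≤ contraction δ A := by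
  unfold contraction
  split_ifs <;> linarith

theorem contraction_le_one {δ : ℝ} (h0 : 0 ≤ δ)
    (A : Matrix (Fin (r + 1)) (Fin (r + 1)) ℝ) : contraction δ A ≤ 1 := by
  unfold contraction
  split_ifs <;> linarith

theorem abs_leftProd_sub_le_prod_contraction {x : ℕ → Matrix (Fin (r + 1)) (Fin (r + 1)) ℝ}
    (hx : ∀ n, x n ∈ Matrix.rowStochastic ℝ (Fin (r + 1))) (δ : ℝ) (m n : ℕ)
    (k l j : Fin (r + 1)) :
    |leftProd x (m * n) k j - leftProd x (m * n) l j| ≤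
      ∏ i ∈ Finset.range n, contraction δ (blockProd m i x) := by
  induction n generalizing k l with
  | zero =>
    simp only [Nat.mul_zero, leftProd, Finset.range_zero, Finset.prod_empty, Matrix.one_apply]
    split_ifs <;> simp
  | succ n ih =>
    rw [Nat.mul_succ, leftProd_add, Finset.prod_range_succ, mul_comm (Finset.prod _ _)]
    have hB : blockProd m n x ∈ Matrix.rowStochastic ℝ (Fin (r + 1)) :=
      leftProd_mem_rowStochastic (fun i => hx (m * n + i)) m
    by_cases h : ∀ i j, δ ≤ blockProd m n x i j
    · rw [contraction, if_pos h]
      exact abs_mulVec_sub_mulVec_le hB h (v := fun i => leftProd x (m * n) i j) ih k l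
    -- A block without the lower bound `δ` still does not expand: take the lower bound `0`.
    · rw [contraction, if_neg h, ← sub_zero (1 : ℝ)]
      exact abs_mulVec_sub_mulVec_le hB (δ := 0)
        (fun _ _ => Matrix.nonneg_of_mem_rowStochastic hB)
        (v := fun i => leftProd x (m * n) i j) ih k l

theorem blockProd_congr {m i : ℕ} {x y : ℕ → Matrix (Fin (r + 1)) (Fin (r + 1)) ℝ}
    (h : ∀ k ∈ Finset.Ico (m * i) (m * (i + 1)), x k = y k) :
    blockProd m i x = blockProd m i y :=
  leftProd_congr fun k hk => h _ (by rw [Finset.mem_Ico, Nat.mul_succ]; omega)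

variable {Ω : Type*} [MeasurableSpace Ω] {μ : Measure Ω}
  {X : ℕ → Ω → Matrix (Fin (r + 1)) (Fin (r + 1)) ℝ}

theorem integral_contraction [IsProbabilityMeasure μ] (δ : ℝ) {Z : Ω → Matrix (Fin (r + 1)) (Fin (r + 1)) ℝ}
    (hZ : Measurable Z) :
    ∫ ω, contraction δ (Z ω) ∂μ = 1 - δ * μ.real {ω | ∀ i j, δ ≤ Z ω i j} := by
  have hm : MeasurableSet {ω | ∀ i j, δ ≤ Z ω i j} := hZ (measurableSet_forall_le_entry δ)
  have h : (fun ω => contraction δ (Z ω)) =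
      fun ω => 1 - {ω | ∀ i j, δ ≤ Z ω i j}.indicator (fun _ => δ) ω := by
    funext ω
    by_cases hω : ∀ i j, δ ≤ Z ω i j
    · simp [contraction, Set.indicator, hω]
    · simp [contraction, Set.indicator, hω]
  rw [h, integral_sub (integrable_const _) ((integrable_const δ).indicator hm),
    integral_indicator_const _ hm]
  simp [mul_comm]

/-- Both laws are the infinite power of the common law of the `X n`; hence all blocks have the law
of the first. -/
theorem map_shift_eq_map (hXmeas : ∀ n, Measurable (X n)) (hXindep : iIndepFun X μ)
    (hXident : ∀ n, IdentDistrib (X n) (X 0) μ μ) (N : ℕ) :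
    μ.map (fun ω i => X (N + i) ω) = μ.map (fun ω i => X i ω) := by
  rw [(hXindep.precomp (add_right_injective N)).map_fun_eq_infinitePi_map
      (fun i => hXmeas (N + i)), hXindep.map_fun_eq_infinitePi_map hXmeas]
  congr 1
  funext i
  exact (hXident (N + i)).map_eq.trans (hXident i).map_eq.symm

theorem measureReal_blockProd [IsProbabilityMeasure μ] (hXmeas : ∀ n, Measurable (X n)) (hXindep : iIndepFun X μ)
    (hXident : ∀ n, IdentDistrib (X n) (X 0) μ μ) (δ : ℝ) (m n : ℕ) :
    μ.real {ω | ∀ i j, δ ≤ blockProd m n (fun i => X i ω) i j} =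
      μ.real {ω | ∀ i j, δ ≤ leftProd (fun i => X i ω) m i j} := by
  have hs : MeasurableSet {x : ℕ → Matrix (Fin (r + 1)) (Fin (r + 1)) ℝ |
      ∀ i j, δ ≤ leftProd x m i j} := measurable_leftProd m (measurableSet_forall_le_entry δ)
  have h := congrArg (fun ν => ν {x : ℕ → Matrix (Fin (r + 1)) (Fin (r + 1)) ℝ |
      ∀ i j, δ ≤ leftProd x m i j}) (map_shift_eq_map hXmeas hXindep hXident (m * n))
  beta_reduce at h
  rw [Measure.map_apply (measurable_pi_lambda _ fun i => hXmeas _) hs,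
    Measure.map_apply (measurable_pi_lambda _ hXmeas) hs] at h
  exact congrArg ENNReal.toReal h

theorem integral_prod_contraction [IsProbabilityMeasure μ] (hXmeas : ∀ n, Measurable (X n)) (hXindep : iIndepFun X μ)
    (hXident : ∀ n, IdentDistrib (X n) (X 0) μ μ) (δ : ℝ) (m n : ℕ) :
    ∫ ω, ∏ i ∈ Finset.range n, contraction δ (blockProd m i fun k => X k ω) ∂μ =
      (1 - δ * μ.real {ω | ∀ i j, δ ≤ leftProd (fun i => X i ω) m i j}) ^ n := by
  induction n with
  | zero => simp
  | succ n ih =>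
    have hpm : Measurable fun x : ℕ → Matrix (Fin (r + 1)) (Fin (r + 1)) ℝ =>
        ∏ i ∈ Finset.range n, contraction δ (blockProd m i x) :=
      Finset.measurable_prod _ fun i _ =>
        (measurable_contraction δ).comp (measurable_blockProd m i)
    have hcm : Measurable fun x : ℕ → Matrix (Fin (r + 1)) (Fin (r + 1)) ℝ =>
        contraction δ (blockProd m n x) :=
      (measurable_contraction δ).comp (measurable_blockProd m n)
    have hmX : Measurable fun ω i => X i ω := measurable_pi_lambda _ hXmeas
    -- The first `n` blocks use only indices below `m * n`, the next block only those from `m * n`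
    -- on.
    have hind := hXindep.indepFun_of_dependsOn hXmeas
      (S := Finset.Ico 0 (m * n)) (T := Finset.Ico (m * n) (m * (n + 1)))
      (Finset.Ico_disjoint_Ico_consecutive _ _ _) hpm hcm
      (fun x y h => Finset.prod_congr rfl fun i hi => congrArg _ (blockProd_congr fun k hk => h k (by
        have hi' : m * (i + 1) ≤ m * n := Nat.mul_le_mul_left m (Finset.mem_range.1 hi)
        simp only [Finset.coe_Ico, Set.mem_Ico, Nat.zero_le, true_and]
        exact (Finset.mem_Ico.1 hk).2.trans_le hi')))
      (fun x y h => congrArg _ (blockProd_congr fun k hk => h k (Finset.mem_coe.2 hk)))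
    simp only [Finset.prod_range_succ]
    rw [hind.integral_fun_mul_eq_mul_integral (hpm.comp hmX).aestronglyMeasurable
      (hcm.comp hmX).aestronglyMeasurable, ih, pow_succ]
    congr 1
    rw [← measureReal_blockProd hXmeas hXindep hXident δ m n]
    exact integral_contraction δ ((measurable_blockProd m n).comp hmX)

/-- Under **C2** the left products converge almost surely to a random matrix with equal rows. -/
theorem ae_exists_tendsto_leftProd [IsProbabilityMeasure μ] (hXmeas : ∀ n, Measurable (X n))
    (hXstoch : ∀ n ω, X n ω ∈ Matrix.rowStochastic ℝ (Fin (r + 1)))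
    (hXindep : iIndepFun X μ) (hXident : ∀ n, IdentDistrib (X n) (X 0) μ μ)
    (hC2 : CondC2 μ X) :
    ∀ᵐ ω ∂μ, ∃ y : Fin (r + 1) → ℝ, ∀ k,
      Tendsto (fun n => leftProd (fun i => X i ω) n k) atTop (𝓝 y) := by
  obtain ⟨m, -, hm⟩ := hC2
  -- Positivity of all entries is the countable union over `N` of the events with lower bound `1 /
  -- (N + 1)`, so one of these has positive probability.
  obtain ⟨N, hN⟩ : ∃ N : ℕ, 0 < μ {ω | ∀ i j, 1 / ((N : ℝ) + 1) ≤
      leftProd (fun n => X n ω) m i j} := by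
    by_contra! hcon
    refine hm.ne' (measure_mono_null ?_ (measure_iUnion_null fun N => nonpos_iff_eq_zero.1 (hcon N)))
    intro ω hω
    obtain ⟨q, hq⟩ := Finite.exists_min
      fun q : Fin (r + 1) × Fin (r + 1) => leftProd (fun n => X n ω) m q.1 q.2
    obtain ⟨N, hN⟩ := exists_nat_one_div_lt (hω q.1 q.2)
    exact Set.mem_iUnion.2 ⟨N, fun i j => hN.le.trans (hq (i, j))⟩
  set δ : ℝ := 1 / ((N : ℝ) + 1) with hδ
  have hδ0 : 0 < δ := by positivity
  have hδ1 : δ ≤ 1 := by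
    rw [hδ, div_le_one (by positivity)]
    linarith [(Nat.cast_nonneg N : (0 : ℝ) ≤ N)]
  set ρ : ℝ := 1 - δ * μ.real {ω | ∀ i j, δ ≤ leftProd (fun i => X i ω) m i j} with hρ
  have hp : 0 < μ.real {ω | ∀ i j, δ ≤ leftProd (fun i => X i ω) m i j} :=
    ENNReal.toReal_pos hN.ne' (measure_ne_top _ _)
  have hρ1 : ρ < 1 := by
    have := mul_pos hδ0 hp
    linarith
  have hρ0 : 0 ≤ ρ := by
    have := mul_le_one₀ hδ1 hp.le (measureReal_le_one (μ := μ))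
    linarith
  let D (n : ℕ) (ω : Ω) : ℝ :=
    ∏ i ∈ Finset.range n, contraction δ (blockProd m i fun k => X k ω)
  have hD0 (n ω) : 0 ≤ D n ω := Finset.prod_nonneg fun i _ => contraction_nonneg hδ1 _
  have hD1 (n ω) : D n ω ≤ 1 :=
    Finset.prod_le_one (fun i _ => contraction_nonneg hδ1 _) fun i _ => contraction_le_one hδ0.le _
  have hDm (n) : Measurable (D n) := Finset.measurable_prod _ fun i _ =>
    (measurable_contraction δ).comp ((measurable_blockProd m i).comp (measurable_pi_lambda _ hXmeas))
  have hDi (n) : Integrable (D n) μ :=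
    Integrable.of_bound (hDm n).aestronglyMeasurable 1
      (ae_of_all _ fun ω => by rw [Real.norm_of_nonneg (hD0 n ω)]; exact hD1 n ω)
  -- The expectations of the `D n` form a geometric series with ratio `ρ < 1`, so `∑ D n` is almost
  -- surely finite and its terms tend to zero.
  have hsum : ∫⁻ ω, ∑' n, ENNReal.ofReal (D n ω) ∂μ ≠ ⊤ := by
    rw [lintegral_tsum fun n => (hDm n).ennreal_ofReal.aemeasurable]
    have h (n) : ∫⁻ ω, ENNReal.ofReal (D n ω) ∂μ = ENNReal.ofReal (ρ ^ n) := by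
      rw [← ofReal_integral_eq_lintegral_ofReal (hDi n) (ae_of_all _ (hD0 n)),
        integral_prod_contraction hXmeas hXindep hXident]
    simp only [h]
    exact (summable_geometric_of_lt_one hρ0 hρ1).tsum_ofReal_ne_top
  filter_upwards [ae_lt_top' (AEMeasurable.tsum
    fun n => (hDm n).ennreal_ofReal.aemeasurable) hsum] with ω hω
  have hD : Tendsto (fun n => D n ω) atTop (𝓝 0) := by
    have := (ENNReal.tendsto_toReal ENNReal.zero_ne_top).comp
      (ENNReal.tendsto_atTop_zero_of_tsum_ne_top hω.ne)
    simpa only [Function.comp_def, ENNReal.toReal_ofReal (hD0 _ ω), ENNReal.toReal_zero] using this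
  refine exists_tendsto_leftProd (fun n => hXstoch n ω) fun ε hε => ?_
  obtain ⟨n, hn⟩ := (hD.eventually (gt_mem_nhds hε)).exists
  exact ⟨m * n, fun k l j => (abs_leftProd_sub_le_prod_contraction (fun n => hXstoch n ω)
    δ m n k l j).trans hn.le⟩

end Convergence

/-! ### Normalized gamma vectors and the Dirichlet law -/

section Dirichlet

open scoped ENNReal

theorem _root_.MeasureTheory.lintegral_fin_prod_eq_prod {n : ℕ} (f : Fin n → ℝ → ℝ≥0∞)
    (hf : ∀ i, Measurable (f i)) :
    ∫⁻ x : Fin n → ℝ, ∏ i, f i (x i) = ∏ i, ∫⁻ x, f i x := by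
  induction n with
  | zero => simp [volume_pi]
  | succ n ih =>
    rw [← (volume_preserving_piFinSuccAbove (fun _ => ℝ) 0).symm.lintegral_comp_emb
      (MeasurableEquiv.measurableEmbedding _), Fin.prod_univ_succ, ← ih _ fun i => hf i.succ,
      ← lintegral_prod_mul (hf 0).aemeasurable
        (Finset.measurable_prod _ fun i _ => (hf i.succ).comp (measurable_pi_apply i)).aemeasurable]
    refine lintegral_congr fun q => ?_
    rw [Fin.prod_univ_succ]
    simp [MeasurableEquiv.piFinSuccAbove]

theorem _root_.MeasureTheory.pi_withDensity_fin {n : ℕ} (f : Fin n → ℝ → ℝ≥0∞)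
    (hf : ∀ i, Measurable (f i)) [∀ i, SigmaFinite ((volume : Measure ℝ).withDensity (f i))] :
    Measure.pi (fun i => (volume : Measure ℝ).withDensity (f i)) =
      (volume : Measure (Fin n → ℝ)).withDensity fun x => ∏ i, f i (x i) := by
  refine Measure.pi_eq fun s hs => ?_
  rw [withDensity_apply _ (MeasurableSet.univ_pi hs),
    ← lintegral_indicator (MeasurableSet.univ_pi hs)]
  simp_rw [withDensity_apply _ (hs _), ← lintegral_indicator (hs _)]
  rw [← lintegral_fin_prod_eq_prod _ fun i => (hf i).indicator (hs i)]
  refine lintegral_congr fun x => ?_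
  by_cases hx : x ∈ Set.univ.pi s
  · rw [Set.indicator_of_mem hx]
    exact Finset.prod_congr rfl fun i _ => (Set.indicator_of_mem (hx i trivial) _).symm
  · rw [Set.indicator_of_notMem hx]
    obtain ⟨i, hi⟩ : ∃ i, x i ∉ s i := by simpa using hx
    exact (Finset.prod_eq_zero (Finset.mem_univ i) (Set.indicator_of_notMem hi _)).symm

theorem _root_.MeasureTheory.lintegral_eq_mul_lintegral_comp_smul {r : ℕ} {s : ℝ} (hs : 0 < s)
    (g : (Fin r → ℝ) → ℝ≥0∞) :
    ∫⁻ x, g x = ENNReal.ofReal (s ^ r) * ∫⁻ u, g (s • u) := by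
  have h := Measure.map_addHaar_smul (volume : Measure (Fin r → ℝ)) hs.ne'
  have h2 : ∫⁻ u, g (s • u) = ∫⁻ x, g x ∂((volume : Measure (Fin r → ℝ)).map (s • ·)) :=
    ((Homeomorph.smulOfNeZero s hs.ne').toMeasurableEquiv.measurableEmbedding.lintegral_map g).symm
  rw [h2, h, lintegral_smul_measure, smul_eq_mul, ← mul_assoc,
    ← ENNReal.ofReal_mul (by positivity), Module.finrank_fin_fun, abs_of_pos (by positivity),
    mul_inv_cancel₀ (by positivity), ENNReal.ofReal_one, one_mul]

variable {r : ℕ}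

theorem sum_hyperplaneChart (u : Fin r → ℝ) : ∑ i, hyperplaneChart r u i = 1 := by
  simp [hyperplaneChart, Fin.sum_univ_castSucc]

theorem measurable_hyperplaneChart : Measurable (hyperplaneChart r) := by
  refine measurable_pi_lambda _ fun i => ?_
  induction i using Fin.lastCases with
  | last =>
    simp only [hyperplaneChart, Fin.snoc_last]
    fun_prop
  | cast i =>
    simp only [hyperplaneChart, Fin.snoc_castSucc]
    fun_prop

/-- Integration in the coordinates `(s, u) ↦ s • hyperplaneChart u`, where `s` is the sum of the
coordinates. -/
theorem lintegral_eq_lintegral_smul_hyperplaneChart {F : (Fin (r + 1) → ℝ) → ℝ≥0∞}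
    (hF : Measurable F) (hF0 : ∀ x, ∑ i, x i < 0 → F x = 0) :
    ∫⁻ x, F x = ∫⁻ s in Set.Ioi (0 : ℝ),
      ENNReal.ofReal (s ^ r) * ∫⁻ u : Fin r → ℝ, F (s • hyperplaneChart r u) := by
  let J (s : ℝ) (x : Fin r → ℝ) : Fin (r + 1) → ℝ := Fin.snoc (α := fun _ => ℝ) x (s - ∑ i, x i)
  have hJ : Measurable fun q : (Fin r → ℝ) × ℝ => J q.2 q.1 := by
    refine measurable_pi_lambda _ fun i => ?_
    induction i using Fin.lastCases with
    | last =>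
      simp only [J, Fin.snoc_last]
      fun_prop
    | cast i =>
      simp only [J, Fin.snoc_castSucc]
      fun_prop
  have hJsum (s x) : ∑ i, J s x i = s := by simp [J, Fin.sum_univ_castSucc]
  have h1 : ∫⁻ x, F x = ∫⁻ s, ∫⁻ x, F (J s x) := by
    rw [← (volume_preserving_piFinSuccAbove (fun _ => ℝ) (Fin.last r)).symm.lintegral_comp_emb
      (MeasurableEquiv.measurableEmbedding _)]
    rw [Measure.volume_eq_prod, lintegral_prod_symm _ (by
      exact (hF.comp (MeasurableEquiv.measurable _)).aemeasurable)]
    calc _ = ∫⁻ x : Fin r → ℝ, ∫⁻ s : ℝ, F (J s x) := by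
          refine lintegral_congr fun x => ?_
          -- Translating the last coordinate makes `s` the sum of all coordinates.
          rw [← lintegral_sub_right_eq_self _ (∑ i, x i)]
          refine lintegral_congr fun s => ?_
          congr 1
          simp [MeasurableEquiv.piFinSuccAbove, J]
          rfl
      _ = _ := lintegral_lintegral_swap (hF.comp hJ).aemeasurable
  have h2 : ∫⁻ s, ∫⁻ x, F (J s x) = ∫⁻ s in Set.Ioi (0 : ℝ), ∫⁻ x, F (J s x) := by
    rw [setLIntegral_congr Ioi_ae_eq_Ici]
    refine (setLIntegral_eq_of_support_subset fun s hs => ?_).symm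
    by_contra hs0
    refine hs ?_
    have h0 (x) : F (J s x) = 0 := hF0 _ (by rw [hJsum]; exact not_le.1 hs0)
    simp only [h0, lintegral_zero]
  rw [h1, h2]
  refine setLIntegral_congr_fun measurableSet_Ioi fun s hs => ?_
  have hs : 0 < s := hs
  rw [lintegral_eq_mul_lintegral_comp_smul hs]
  congr 1
  refine lintegral_congr fun u => ?_
  congr 1
  funext i
  induction i using Fin.lastCases with
  | last => simp [J, hyperplaneChart, ← Finset.mul_sum, mul_sub]
  | cast i => simp [J, hyperplaneChart]

theorem gammaVectorMeasure_eq_withDensity {a : Fin (r + 1) → ℝ} (ha : ∀ i, 0 < a i) :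
    gammaVectorMeasure a = (volume : Measure (Fin (r + 1) → ℝ)).withDensity
      fun x => ∏ i, gammaPDF (a i) 1 (x i) := by
  have h (i) : IsProbabilityMeasure ((volume : Measure ℝ).withDensity (gammaPDF (a i) 1)) :=
    isProbabilityMeasure_gammaMeasure (ha i) one_pos
  exact pi_withDensity_fin (fun i => gammaPDF (a i) 1)
    fun i => (measurable_gammaPDFReal (a i) 1).ennreal_ofReal

theorem isProbabilityMeasure_gammaVectorMeasure {a : Fin (r + 1) → ℝ} (ha : ∀ i, 0 < a i) :
    IsProbabilityMeasure (gammaVectorMeasure a) := by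
  have h (i) : IsProbabilityMeasure (gammaMeasure (a i) 1) :=
    isProbabilityMeasure_gammaMeasure (ha i) one_pos
  unfold gammaVectorMeasure
  infer_instance

/-- The density of `G_a` factorizes in the coordinates `s`, `y` with `x = s y`, `∑ yᵢ = 1`. -/
theorem mul_prod_gammaPDF_smul {a : Fin (r + 1) → ℝ} (ha : ∀ i, 0 < a i) {s : ℝ} (hs : 0 < s)
    {y : Fin (r + 1) → ℝ} (hy : ∑ i, y i = 1) :
    ENNReal.ofReal (s ^ r) * ∏ i, gammaPDF (a i) 1 ((s • y) i) =
      gammaPDF (∑ i, a i) 1 s * (stdSimplex ℝ (Fin (r + 1))).indicator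
        (fun y => ENNReal.ofReal (dirichletPDFReal a y)) y := by
  have hA : 0 < ∑ i, a i := Finset.sum_pos (fun i _ => ha i) Finset.univ_nonempty
  by_cases hy0 : ∀ i, 0 ≤ y i
  · rw [Set.indicator_of_mem (show y ∈ stdSimplex ℝ (Fin (r + 1)) from ⟨hy0, hy⟩)]
    have hΓ : Real.Gamma (∑ i, a i) ≠ 0 := (Real.Gamma_pos_of_pos hA).ne'
    simp only [gammaPDF]
    rw [← ENNReal.ofReal_prod_of_nonneg fun i _ => gammaPDFReal_nonneg (ha i) one_pos _,
      ← ENNReal.ofReal_mul (by positivity),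
      ← ENNReal.ofReal_mul (gammaPDFReal_nonneg hA one_pos _)]
    congr 1
    have hfac (i) : gammaPDFReal (a i) 1 ((s • y) i) =
        (s ^ (a i - 1) * Real.exp (-(s * y i))) * (y i ^ (a i - 1) / Real.Gamma (a i)) := by
      have h0 : 0 ≤ s * y i := mul_nonneg hs.le (hy0 i)
      rw [Pi.smul_apply, smul_eq_mul, gammaPDFReal, if_pos h0, Real.one_rpow, one_mul,
        Real.mul_rpow hs.le (hy0 i)]
      ring
    simp only [hfac, Finset.prod_mul_distrib]
    rw [← Real.rpow_sum_of_pos hs, ← Real.exp_sum, Finset.sum_neg_distrib, ← Finset.mul_sum, hy,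
      gammaPDFReal, if_pos hs.le, dirichletPDFReal, Real.one_rpow, one_mul]
    -- There are `r + 1` shapes, so `∑ (aᵢ - 1)` falls short of `∑ aᵢ - 1` by `r`; the Jacobian `s ^
    -- r` makes up for it.
    have hpow : s ^ (∑ i, a i - 1) = s ^ r * s ^ ∑ i, (a i - 1) := by
      rw [← Real.rpow_natCast s r, ← Real.rpow_add hs]
      congr 1
      simp
      ring
    rw [hpow, mul_one]
    field_simp
  · rw [Set.indicator_of_notMem fun h => hy0 h.1, mul_zero]
    obtain ⟨i, hi⟩ : ∃ i, y i < 0 := by simpa using hy0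
    rw [Finset.prod_eq_zero (Finset.mem_univ i), mul_zero]
    exact gammaPDF_of_neg (mul_neg_of_pos_of_neg hs hi)

theorem measurable_dirichletPDFReal (a : Fin (r + 1) → ℝ) : Measurable (dirichletPDFReal a) := by
  unfold dirichletPDFReal
  fun_prop

theorem measurableSet_stdSimplex : MeasurableSet (stdSimplex ℝ (Fin (r + 1))) :=
  (isClosed_stdSimplex ℝ (Fin (r + 1))).measurableSet

theorem dirichletMeasure_apply (a : Fin (r + 1) → ℝ) {S : Set (Fin (r + 1) → ℝ)}
    (hS : MeasurableSet S) :
    dirichletMeasure a S = ∫⁻ u, S.indicator 1 (hyperplaneChart r u) *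
      (stdSimplex ℝ (Fin (r + 1))).indicator
        (fun y => ENNReal.ofReal (dirichletPDFReal a y)) (hyperplaneChart r u) := by
  have hm : Measurable fun y => ENNReal.ofReal (dirichletPDFReal a y) :=
    (measurable_dirichletPDFReal a).ennreal_ofReal
  rw [dirichletMeasure, withDensity_apply _ hS, ← lintegral_indicator hS, simplexVolume,
    ← lintegral_indicator measurableSet_stdSimplex,
    lintegral_map ((hm.indicator hS).indicator measurableSet_stdSimplex) measurable_hyperplaneChart]
  refine lintegral_congr fun u => ?_
  by_cases h : hyperplaneChart r u ∈ S <;>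
    by_cases h' : hyperplaneChart r u ∈ stdSimplex ℝ (Fin (r + 1)) <;> simp [h, h']

/-- The normalization of a vector of independent gamma variables has the Dirichlet law. -/
theorem map_normalize_gammaVectorMeasure {a : Fin (r + 1) → ℝ} (ha : ∀ i, 0 < a i) :
    (gammaVectorMeasure a).map (fun x => (∑ i, x i)⁻¹ • x) = dirichletMeasure a := by
  have hA : 0 < ∑ i, a i := Finset.sum_pos (fun i _ => ha i) Finset.univ_nonempty
  have hN : Measurable fun x : Fin (r + 1) → ℝ => (∑ i, x i)⁻¹ • x := by fun_prop
  have hpdf : Measurable fun x : Fin (r + 1) → ℝ => ∏ i, gammaPDF (a i) 1 (x i) :=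
    Finset.measurable_prod _ fun i _ =>
      (measurable_gammaPDFReal (a i) 1).ennreal_ofReal.comp (measurable_pi_apply i)
  ext S hS
  have hind : Measurable (S.indicator (1 : (Fin (r + 1) → ℝ) → ℝ≥0∞)) :=
    measurable_one.indicator hS
  have hL : (gammaVectorMeasure a).map (fun x => (∑ i, x i)⁻¹ • x) S =
      ∫⁻ x, S.indicator 1 ((∑ i, x i)⁻¹ • x) * ∏ i, gammaPDF (a i) 1 (x i) := by
    rw [← lintegral_indicator_one hS, lintegral_map hind hN, gammaVectorMeasure_eq_withDensity ha,
      lintegral_withDensity_eq_lintegral_mul _ hpdf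
        (g := fun x => S.indicator 1 ((∑ i, x i)⁻¹ • x)) (hind.comp hN)]
    exact lintegral_congr fun x => mul_comm _ _
  have hneg (x : Fin (r + 1) → ℝ) (hx : ∑ i, x i < 0) :
      S.indicator 1 ((∑ i, x i)⁻¹ • x) * ∏ i, gammaPDF (a i) 1 (x i) = 0 := by
    obtain ⟨i, hi⟩ : ∃ i, x i < 0 := by
      by_contra! h
      exact hx.not_ge (Finset.sum_nonneg fun i _ => h i)
    rw [Finset.prod_eq_zero (Finset.mem_univ i) (gammaPDF_of_neg hi), mul_zero]
  -- Normalization removes `s` from the indicator, so the integrand splits into a gamma density in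
  -- `s`, of mass one by `hone`, and a Dirichlet integral in `u`.
  have hpolar (s : ℝ) (hs : 0 < s) : ENNReal.ofReal (s ^ r) * ∫⁻ u : Fin r → ℝ,
      S.indicator 1 ((∑ i, (s • hyperplaneChart r u) i)⁻¹ • (s • hyperplaneChart r u)) *
        ∏ i, gammaPDF (a i) 1 ((s • hyperplaneChart r u) i) =
      gammaPDF (∑ i, a i) 1 s * dirichletMeasure a S := by
    rw [dirichletMeasure_apply a hS, ← lintegral_const_mul' _ _ ENNReal.ofReal_ne_top,
      ← lintegral_const_mul' (gammaPDF (∑ i, a i) 1 s) _ ENNReal.ofReal_ne_top]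
    refine lintegral_congr fun u => ?_
    have hsum : ∑ i, (s • hyperplaneChart r u) i = s := by
      simp only [Pi.smul_apply, smul_eq_mul, ← Finset.mul_sum, sum_hyperplaneChart, mul_one]
    rw [hsum, inv_smul_smul₀ hs.ne', mul_left_comm,
      mul_prod_gammaPDF_smul ha hs (sum_hyperplaneChart u), mul_left_comm]
  have hone : ∫⁻ s in Set.Ioi (0 : ℝ), gammaPDF (∑ i, a i) 1 s = 1 := by
    rw [setLIntegral_congr Ioi_ae_eq_Ici, ← lintegral_gammaPDF_eq_one hA one_pos]
    refine setLIntegral_eq_of_support_subset fun s hs => ?_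
    by_contra hs0
    exact hs (gammaPDF_of_neg (not_le.1 hs0))
  rw [hL, lintegral_eq_lintegral_smul_hyperplaneChart
      (F := fun x => S.indicator 1 ((∑ i, x i)⁻¹ • x) * ∏ i, gammaPDF (a i) 1 (x i))
      ((hind.comp hN).mul hpdf) hneg,
    setLIntegral_congr_fun measurableSet_Ioi hpolar,
    lintegral_mul_const (f := gammaPDF (∑ i, a i) 1) _
      (measurable_gammaPDFReal _ 1).ennreal_ofReal, hone, one_mul]

end Dirichlet

/-! ### Law of the limiting row -/

section LimitLaw

variable {r : ℕ} {Ω : Type*} [MeasurableSpace Ω] {μ : Measure Ω}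
  {X : ℕ → Ω → Matrix (Fin (r + 1)) (Fin (r + 1)) ℝ}

theorem measurable_leftProd_comp (hXmeas : ∀ n, Measurable (X n)) (n : ℕ) :
    Measurable fun ω => leftProd (fun i => X i ω) n :=
  (measurable_leftProd n).comp (measurable_pi_lambda _ hXmeas)

theorem indepFun_leftProd (hXmeas : ∀ n, Measurable (X n)) (hXindep : iIndepFun X μ) (n : ℕ) :
    IndepFun (X n) (fun ω => leftProd (fun i => X i ω) n) μ :=
  hXindep.indepFun_of_dependsOn hXmeas (S := {n}) (T := Finset.range n) (by simp)
    (measurable_pi_apply n) (measurable_leftProd n)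
    (fun _ _ h => h n (by simp))
    (fun _ _ h => leftProd_congr fun i hi => h i (by simpa using hi))

/-- Under **C1** the law `G_t` is invariant under all left products. -/
theorem map_vecMul_leftProd [IsProbabilityMeasure μ] (hXmeas : ∀ n, Measurable (X n))
    (hXindep : iIndepFun X μ) (hXident : ∀ n, IdentDistrib (X n) (X 0) μ μ)
    {t : Fin (r + 1) → ℝ} (hC1 : CondC1 μ (X 0) t) (n : ℕ) :
    ((gammaVectorMeasure t).prod μ).map
        (fun q => Matrix.vecMul q.1 (leftProd (fun i => X i q.2) n)) =
      gammaVectorMeasure t := by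
  have hG := isProbabilityMeasure_gammaVectorMeasure hC1.1
  have hlaw (Z : Ω → Matrix (Fin (r + 1)) (Fin (r + 1)) ℝ) (hZ : Measurable Z) :
      ((gammaVectorMeasure t).prod μ).map (fun q => Matrix.vecMul q.1 (Z q.2)) =
        ((gammaVectorMeasure t).prod (μ.map Z)).map (fun q => Matrix.vecMul q.1 q.2) := by
    have := Measure.map_prod_map (gammaVectorMeasure t) μ measurable_id hZ
    rw [Measure.map_id] at this
    rw [this, Measure.map_map measurable_vecMul (measurable_id.prodMap hZ)]
    rfl
  induction n with
  | zero =>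
    simp only [leftProd, Matrix.vecMul_one]
    simp
  | succ n ih =>
    have hL := measurable_leftProd_comp hXmeas n
    have hXn := hXmeas n
    have hI := (indepFun_iff_map_prod_eq_prod_map_map (hXmeas n).aemeasurable hL.aemeasurable).1
      (indepFun_leftProd hXmeas hXindep n)
    have hpX : IsProbabilityMeasure (μ.map (X n)) := Measure.isProbabilityMeasure_map hXn.aemeasurable
    have hpL : IsProbabilityMeasure (μ.map fun ω => leftProd (fun i => X i ω) n) :=
      Measure.isProbabilityMeasure_map hL.aemeasurable
    have hstep : ((gammaVectorMeasure t).prod (μ.map (X n))).map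
        (fun q => Matrix.vecMul q.1 q.2) = gammaVectorMeasure t := by
      rw [(hXident n).map_eq]
      exact hC1.2
    have ih' : MeasurePreserving (fun q : (Fin (r + 1) → ℝ) × Matrix _ _ ℝ => Matrix.vecMul q.1 q.2)
        ((gammaVectorMeasure t).prod (μ.map fun ω => leftProd (fun i => X i ω) n))
        (gammaVectorMeasure t) := ⟨measurable_vecMul, (hlaw _ hL).symm.trans ih⟩
    -- Write `V (X n * L)` as `(V X n) L`: the vector `V X n` has law `G_t` by `hstep` and is
    -- independent of the earlier product `L`, so the induction hypothesis applies.
    have e1 := (MeasurePreserving.id (gammaVectorMeasure t)).prod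
      (MeasurePreserving.mk (μa := μ) (hXn.prodMk hL) hI)
    have e2 := (measurePreserving_prodAssoc (gammaVectorMeasure t) (μ.map (X n))
      (μ.map fun ω => leftProd (fun i => X i ω) n)).symm
    have e3 := (MeasurePreserving.mk measurable_vecMul hstep).prod
      (MeasurePreserving.id (μ.map fun ω => leftProd (fun i => X i ω) n))
    refine Eq.trans ?_ (ih'.comp (e3.comp (e2.comp e1))).map_eq
    congr 1
    funext q
    exact (Matrix.vecMul_vecMul q.1 (X n q.2) (leftProd (fun i => X i q.2) n)).symm

/-- Weak limits: if `V Lₙ ∼ G` for all `n` and all rows of `Lₙ` converge almost surely to `y`, then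
`(∑ Vᵢ) y ∼ G`. -/
theorem map_sum_smul_eq_of_tendsto [IsProbabilityMeasure μ] {ν : Measure (Fin (r + 1) → ℝ)}
    [IsProbabilityMeasure ν] {L : ℕ → Ω → Matrix (Fin (r + 1)) (Fin (r + 1)) ℝ}
    (hL : ∀ n, Measurable (L n)) {y : Ω → Fin (r + 1) → ℝ} (hy : Measurable y)
    (hlim : ∀ᵐ ω ∂μ, ∀ k, Tendsto (fun n => L n ω k) atTop (𝓝 (y ω)))
    (hlaw : ∀ n, (ν.prod μ).map (fun q => Matrix.vecMul q.1 (L n q.2)) = ν) :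
    (ν.prod μ).map (fun q => (∑ i, q.1 i) • y q.2) = ν := by
  have hLm (n) : Measurable fun q : (Fin (r + 1) → ℝ) × Ω => Matrix.vecMul q.1 (L n q.2) :=
    measurable_vecMul.comp (measurable_fst.prodMk ((hL n).comp measurable_snd))
  have hym : Measurable fun q : (Fin (r + 1) → ℝ) × Ω => (∑ i, q.1 i) • y q.2 := by fun_prop
  have hp : IsProbabilityMeasure ((ν.prod μ).map fun q => (∑ i, q.1 i) • y q.2) :=
    Measure.isProbabilityMeasure_map hym.aemeasurable
  refine ext_of_forall_integral_eq_of_IsFiniteMeasure fun f => ?_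
  have hae : ∀ᵐ q ∂(ν.prod μ), ∀ k, Tendsto (fun n => L n q.2 k) atTop (𝓝 (y q.2)) :=
    Measure.quasiMeasurePreserving_snd.ae hlim
  have hconv : Tendsto (fun n => ∫ q, f (Matrix.vecMul q.1 (L n q.2)) ∂(ν.prod μ)) atTop
      (𝓝 (∫ q, f ((∑ i, q.1 i) • y q.2) ∂(ν.prod μ))) := by
    refine tendsto_integral_of_dominated_convergence (fun _ => ‖f‖)
      (fun n => (f.continuous.measurable.comp (hLm n)).aestronglyMeasurable)
      (integrable_const _) (fun n => ae_of_all _ fun q => f.norm_coe_le_norm _) ?_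
    filter_upwards [hae] with q hq
    refine (f.continuous.tendsto _).comp (tendsto_pi_nhds.2 fun j => ?_)
    simp only [Matrix.vecMul, dotProduct, Pi.smul_apply, smul_eq_mul, Finset.sum_mul]
    exact tendsto_finsetSum _ fun i _ => ((tendsto_pi_nhds.1 (hq i)) j).const_mul _
  have hconst (n) : ∫ q, f (Matrix.vecMul q.1 (L n q.2)) ∂(ν.prod μ) = ∫ v, f v ∂ν := by
    rw [← integral_map (hLm n).aemeasurable f.continuous.aestronglyMeasurable, hlaw n]
  simp only [hconst] at hconv
  rw [integral_map hym.aemeasurable f.continuous.aestronglyMeasurable]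
  exact tendsto_nhds_unique hconv tendsto_const_nhds

theorem ae_sum_pos_gammaVectorMeasure {a : Fin (r + 1) → ℝ} (ha : ∀ i, 0 < a i) :
    ∀ᵐ v ∂(gammaVectorMeasure a), 0 < ∑ i, v i := by
  have h (i) : IsProbabilityMeasure (gammaMeasure (a i) 1) :=
    isProbabilityMeasure_gammaMeasure (ha i) one_pos
  have hpos (i) : ∀ᵐ x ∂(gammaMeasure (a i) 1), 0 < x := by
    rw [gammaMeasure, ae_withDensity_iff (f := gammaPDF (a i) 1) (measurable_gammaPDFReal _ 1).ennreal_ofReal]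
    -- The gamma density vanishes on negative numbers, and `0` is Lebesgue-null.
    filter_upwards [compl_mem_ae_iff.2 (measure_singleton (0 : ℝ))] with x hx0 hx
    refine lt_of_le_of_ne (le_of_not_gt fun hlt => hx (gammaPDF_of_neg hlt)) (Ne.symm hx0)
  have hall : ∀ᵐ v ∂(gammaVectorMeasure a), ∀ i, 0 < v i :=
    ae_all_iff.2 fun i => (Measure.quasiMeasurePreserving_eval (fun i => gammaMeasure (a i) 1) i).ae
      (hpos i)
  filter_upwards [hall] with v hv
  exact Finset.sum_pos (fun i _ => hv i) Finset.univ_nonempty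

/-- If `V ∼ G_a` and `(∑ Vᵢ) y ∼ G_a` for an independent `y` with coordinate sum one, then `y` has
the Dirichlet law. -/
theorem map_eq_dirichletMeasure [IsProbabilityMeasure μ] {a : Fin (r + 1) → ℝ} (ha : ∀ i, 0 < a i)
    {y : Ω → Fin (r + 1) → ℝ} (hy : Measurable y) (hsum : ∀ᵐ ω ∂μ, ∑ i, y ω i = 1)
    (h : ((gammaVectorMeasure a).prod μ).map (fun q => (∑ i, q.1 i) • y q.2) =
      gammaVectorMeasure a) :
    μ.map y = dirichletMeasure a := by
  have hG := isProbabilityMeasure_gammaVectorMeasure ha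
  have hym : Measurable fun q : (Fin (r + 1) → ℝ) × Ω => (∑ i, q.1 i) • y q.2 := by fun_prop
  have hN : Measurable fun x : Fin (r + 1) → ℝ => (∑ i, x i)⁻¹ • x := by fun_prop
  rw [← map_normalize_gammaVectorMeasure ha, ← h, Measure.map_map hN hym]
  have hcongr : (fun x : Fin (r + 1) → ℝ => (∑ i, x i)⁻¹ • x) ∘
      (fun q : (Fin (r + 1) → ℝ) × Ω => (∑ i, q.1 i) • y q.2) =ᵐ[(gammaVectorMeasure a).prod μ]
      y ∘ Prod.snd := by
    filter_upwards [Measure.quasiMeasurePreserving_fst.ae (ae_sum_pos_gammaVectorMeasure ha),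
      Measure.quasiMeasurePreserving_snd.ae hsum] with q hq1 hq2
    simp only [Function.comp_apply, Pi.smul_apply, smul_eq_mul, ← Finset.mul_sum, hq2, mul_one]
    exact inv_smul_smul₀ hq1.ne' _
  rw [Measure.map_congr hcongr, ← Measure.map_map hy measurable_snd, Measure.map_snd_prod,
    measure_univ, one_smul]

end LimitLaw

end NestedSimplices

end

/-! ### Transfer to the affine space -/

theorem theorem5 {r : ℕ} {V P : Type*} [NormedAddCommGroup V] [NormedSpace ℝ V]
    [MetricSpace P] [NormedAddTorsor V P] [MeasurableSpace P] [BorelSpace P]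
    -- `p` lists the vertices of the original simplex; such a frame makes `P` `r`-dimensional
    (p : AffineBasis (Fin (r + 1)) ℝ P)
    {Ω : Type*} [MeasurableSpace Ω] (μ : Measure Ω) [IsProbabilityMeasure μ]
    (X : ℕ → Ω → Matrix (Fin (r + 1)) (Fin (r + 1)) ℝ)
    (hXmeas : ∀ n, Measurable (X n))
    (hXstoch : ∀ n ω, X n ω ∈ Matrix.rowStochastic ℝ (Fin (r + 1)))
    (hXindep : iIndepFun X μ)
    (hXident : ∀ n, IdentDistrib (X n) (X 0) μ μ)
    (t : Fin (r + 1) → ℝ)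
    (hC1 : NestedSimplices.CondC1 μ (X 0) t)
    (hC2 : NestedSimplices.CondC2 μ X) :
    ∃ Y : Ω → P, Measurable Y ∧
      (∀ᵐ ω ∂μ, ∀ k, Tendsto
        (fun n => NestedSimplices.nestedVertices p (fun i => X i ω) n k) atTop (𝓝 (Y ω))) ∧
      HasLaw (fun ω => p.coords (Y ω)) (NestedSimplices.dirichletMeasure t) μ := by
  have hconv := NestedSimplices.ae_exists_tendsto_leftProd hXmeas hXstoch hXindep hXident hC2
  have hLm := NestedSimplices.measurable_leftProd_comp hXmeas
  have hrow (n : ℕ) : Measurable fun ω => NestedSimplices.leftProd (fun i => X i ω) n 0 :=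
    measurable_pi_lambda _ fun j => (NestedSimplices.measurable_entry 0 j).comp (hLm n)
  -- Row `0` provides a measurable version of the limit; uniqueness of limits then extends it to
  -- every row.
  obtain ⟨y, hy, hy0⟩ := measurable_limit_of_tendsto_metrizable_ae
    (fun n => (hrow n).aemeasurable) (hconv.mono fun ω ⟨y, h⟩ => ⟨y, h 0⟩)
  have hlim : ∀ᵐ ω ∂μ, ∀ k, Tendsto (fun n => NestedSimplices.leftProd (fun i => X i ω) n k) atTop (𝓝 (y ω)) := by
    filter_upwards [hconv, hy0] with ω ⟨z, hz⟩ hω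
    rwa [tendsto_nhds_unique hω (hz 0)]
  have hsum : ∀ᵐ ω ∂μ, ∑ i, y ω i = 1 := by
    filter_upwards [hy0] with ω hω
    refine tendsto_nhds_unique (tendsto_finsetSum _ fun i _ => tendsto_pi_nhds.1 hω i) ?_
    simp only [Matrix.sum_row_of_mem_rowStochastic
      (NestedSimplices.leftProd_mem_rowStochastic (fun n => hXstoch n ω) _) 0]
    exact tendsto_const_nhds
  have hG := NestedSimplices.isProbabilityMeasure_gammaVectorMeasure hC1.1
  have hmap : μ.map y = NestedSimplices.dirichletMeasure t :=
    NestedSimplices.map_eq_dirichletMeasure hC1.1 hy hsum (NestedSimplices.map_sum_smul_eq_of_tendsto hLm hy hlim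
      (NestedSimplices.map_vecMul_leftProd hXmeas hXindep hXident hC1))
  have hcont := NestedSimplices.continuous_affineCombination (p : Fin (r + 1) → P)
  -- Coordinates recover `y` only where its entries sum to one, hence the almost sure equality.
  have hcoords : (fun ω => p.coords (Finset.univ.affineCombination ℝ p (y ω))) =ᵐ[μ] y := by
    filter_upwards [hsum] with ω hω
    funext i
    exact p.coord_apply_combination_of_mem (Finset.mem_univ i) hω
  refine ⟨fun ω => Finset.univ.affineCombination ℝ p (y ω), hcont.measurable.comp hy, ?_,
    hy.aemeasurable.congr hcoords.symm, (Measure.map_congr hcoords).trans hmap⟩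
  filter_upwards [hlim] with ω hω k
  simp only [NestedSimplices.nestedVertices_eq_affineCombination (p : Fin (r + 1) → P) fun n => hXstoch n ω]
  exact (hcont.tendsto _).comp (hω k)
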